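/- Let $\ell_\infty$ be the Banach space of bounded functions $\mathbb{Z}\to\mathbb{K}$ with the supremum norm, where $\mathbb{K}=\mathbb{C}$ (or $\mathbb{K}=\mathbb{R}$), and let $\ell_\infty^d=\mathbb{K}^d$ carry the supremum norm. Definitions. For a bounded linear map $\gamma:X\to Y$ of Banach spaces, $\Omega\subseteq X$ and $\delta>0$, let $\mathrm{CA}(\gamma,\Omega,\delta)$ be the collection of triples $(\phi,\psi,d)$ with $d$ a positive integer and $\phi:X\to\ell_\infty^d$, $\psi:\ell_\infty^d\to Y$ contractive linear maps such that $\|\psi(\phi(x))-\gamma(x)\|<\delta$ for all $x\in\Omega$. A CA embedding of $X$ is an isometric linear map $\iota:X\to Y$ into a Banach space such that $\mathrm{CA}(\iota,\Omega,\delta)\neq\emptyset$ for all finite $\Omega\subseteq X$ and all $\delta>0$. Given a CA embedding $\iota$ of $X$, put $\mathrm{rc}(\Omega,\delta)=\min\{d:(\phi,\psi,d)\in\mathrm{CA}(\iota,\Omega,\delta)\}$, and define the CA entropy of an isometric (linear) automorphism $\alpha$ of $X$ by $$\mathrm{hc}(\alpha)=\sup_{\Omega\subseteq X\text{ finite}}\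 \sup_{\delta>0}\ \limsup_{n\to\infty}\frac1n\log\mathrm{rc}(\Omega\cup\alpha\Omega\cup\cdots\cup\alpha^{n-1}\Omega,\delta)\in[0,\infty].$$ Statement. Let $\alpha$ be an isometric automorphism of $\ell_\infty$. Then there is a unique permutation $\sigma$ of $\mathbb{Z}$ for which there is a sequence $\lambda:\mathbb{Z}\to\{z\in\mathbb{K}:|z|=1\}$ with $\alpha(x)(s)=\lambda(s)\,x(\sigma(s))$ for all $x\in\ell_\infty$ and $s\in\mathbb{Z}$. For every CA embedding $\iota$ of $\ell_\infty$ through which $\mathrm{hc}$ is computed: if there is a finite bound on the cardinality of the orbits of $\sigma$, then $\mathrm{hc}(\alpha)=0$; if there is no such bound, then $\mathrm{hc}(\alpha)=\infty$. -/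

import Mathlib

open scoped ENNReal

/-- `ℓ_∞` over the scalars `𝕜`, indexed over `ℤ`. -/
abbrev EllInfty (𝕜 : Type*) [RCLike 𝕜] := lp (fun _ : ℤ => 𝕜) ∞

section CA

variable {𝕜 : Type*} [RCLike 𝕜]
variable {X : Type*} [NormedAddCommGroup X] [NormedSpace 𝕜 X]
variable {Y : Type*} [NormedAddCommGroup Y] [NormedSpace 𝕜 Y]

/-- `CA γ Ω δ d` is the set of pairs `(φ, ψ)` of contractive linear maps `φ : X → ℓ_∞^d` and
`ψ : ℓ_∞^d → Y` with `‖ψ (φ x) - γ x‖ < δ` for all `x ∈ Ω`. (The norm of `Fin d → 𝕜` is the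
supremum norm.) -/
def CA (γ : X →L[𝕜] Y) (Ω : Set X) (δ : ℝ) (d : ℕ) :
    Set ((X →L[𝕜] (Fin d → 𝕜)) × ((Fin d → 𝕜) →L[𝕜] Y)) :=
  {p | ‖p.1‖ ≤ 1 ∧ ‖p.2‖ ≤ 1 ∧ ∀ x ∈ Ω, ‖p.2 (p.1 x) - γ x‖ < δ}

/-- A CA embedding: an isometric linear map that can be approximated on finite sets by contractive
maps through the spaces `ℓ_∞^d` with `d` a positive integer. -/
def IsCAEmbedding (ι : X →ₗᵢ[𝕜] Y) : Prop :=
  ∀ Ω : Set X, Ω.Finite → ∀ δ : ℝ, 0 < δ →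
    ∃ d : ℕ, 0 < d ∧ (CA ι.toContinuousLinearMap Ω δ d).Nonempty

/-- The contractive rank `rc(Ω, δ)`, computed through `ι`: the least positive integer `d` for which
there is an approximation through `ℓ_∞^d`. It exists if `ι` is a CA embedding, `Ω` is finite and
`δ > 0`. -/
noncomputable def rc (ι : X →ₗᵢ[𝕜] Y) (Ω : Set X) (δ : ℝ) : ℕ :=
  sInf {d : ℕ | 0 < d ∧ (CA ι.toContinuousLinearMap Ω δ d).Nonempty}

/-- `Ω ∪ α Ω ∪ ⋯ ∪ α ^ (n - 1) Ω`. -/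
def iterUnion (α : X ≃ₗᵢ[𝕜] X) (Ω : Set X) (n : ℕ) : Set X :=
  ⋃ k ∈ Finset.range n, (α ^ k) '' Ω

/-- `hc(α, Ω, δ) = limsup_{n → ∞} (1/n) log rc(Ω ∪ ⋯ ∪ α ^ (n - 1) Ω, δ)`. -/
noncomputable def hcAt (ι : X →ₗᵢ[𝕜] Y) (α : X ≃ₗᵢ[𝕜] X) (Ω : Set X) (δ : ℝ) : EReal :=
  Filter.limsup
    (fun n : ℕ => (((1 / n : ℝ) * Real.log (rc ι (iterUnion α Ω n) δ) : ℝ) : EReal)) Filter.atTop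

/-- `hc(α, Ω) = sup_{δ > 0} hc(α, Ω, δ)`. -/
noncomputable def hcOn (ι : X →ₗᵢ[𝕜] Y) (α : X ≃ₗᵢ[𝕜] X) (Ω : Set X) : EReal :=
  ⨆ (δ : ℝ) (_ : 0 < δ), hcAt ι α Ω δ

/-- The contractive approximation entropy `hc(α)` of the isometric automorphism `α`, computed
through `ι` (which has to be a CA embedding): the supremum of `hc(α, Ω)` over the finite subsets
`Ω` of `X`. -/
noncomputable def hc (ι : X →ₗᵢ[𝕜] Y) (α : X ≃ₗᵢ[𝕜] X) : EReal :=
  ⨆ (Ω : Set X) (_ : Ω.Finite), hcOn ι α Ω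

end CA

/-- `σ` is a permutation of `ℤ` associated to the isometric automorphism `α` of `ℓ_∞`:
`α(x)(s) = lam(s) x(σ(s))` for a sequence `lam` of unimodular scalars. -/
def IsAssociatedPerm {𝕜 : Type*} [RCLike 𝕜] (α : EllInfty 𝕜 ≃ₗᵢ[𝕜] EllInfty 𝕜)
    (σ : Equiv.Perm ℤ) : Prop :=
  ∃ lam : ℤ → 𝕜, (∀ s, ‖lam s‖ = 1) ∧ ∀ (x : EllInfty 𝕜) (s : ℤ), α x s = lam s * x (σ s)

/-- There is a finite bound on the cardinality of the orbits of `σ`. -/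
def HasBoundedOrbits (σ : Equiv.Perm ℤ) : Prop :=
  ∃ N : ℕ, ∀ s : ℤ, (MulAction.orbit (Subgroup.zpowers σ) s).encard ≤ N

/-- Non-vacuity: the identity of `ℓ_∞` is a CA embedding. -/
theorem isCAEmbedding_id (𝕜 : Type*) [RCLike 𝕜] :
    IsCAEmbedding (LinearIsometry.id : EllInfty 𝕜 →ₗᵢ[𝕜] EllInfty 𝕜) := by
  intro Ω hΩ δ hδ
  have := hΩ.fintype
  let v : ℤ → (Ω → 𝕜) := fun s x => x.1 s
  have hb : Bornology.IsBounded (Set.range v) := by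
    rw [isBounded_iff_forall_norm_le]
    refine ⟨∑ x : Ω, ‖x.1‖, ?_⟩
    rintro _ ⟨s, rfl⟩
    rw [pi_norm_le_iff_of_nonneg (Finset.sum_nonneg fun _ _ => norm_nonneg _)]
    intro x
    exact (lp.norm_apply_le_norm (by simp) x.1 s).trans
      (Finset.single_le_sum (f := fun x : Ω => ‖x.1‖) (fun _ _ => norm_nonneg _)
        (Finset.mem_univ x))
  obtain ⟨t, hts, htf, hcov⟩ := Metric.finite_approx_of_totallyBounded
    (hb.isCompact_closure.totallyBounded.subset subset_closure) (δ / 2) (half_pos hδ)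
  have := htf.fintype
  have hp : ∀ s, ∃ y : t, dist (v s) y.1 < δ / 2 := by
    intro s
    have := hcov ⟨s, rfl⟩
    simp only [Set.mem_iUnion, Metric.mem_ball] at this
    obtain ⟨y, hy, h⟩ := this
    exact ⟨⟨y, hy⟩, h⟩
  choose p hp using hp
  have hr : ∀ y : t, ∃ s, v s = y.1 := fun y => hts y.2
  choose r hr using hr
  let e := Fintype.equivFin t
  let φ : EllInfty 𝕜 →ₗ[𝕜] (Fin (Fintype.card t) → 𝕜) :=
    { toFun := fun x i => x (r (e.symm i))
      map_add' := fun _ _ => rfl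
      map_smul' := fun _ _ => rfl }
  have hφ : ∀ x, ‖φ x‖ ≤ 1 * ‖x‖ := by
    intro x
    rw [one_mul, pi_norm_le_iff_of_nonneg (norm_nonneg _)]
    exact fun i => lp.norm_apply_le_norm (by simp) x _
  let ψ : (Fin (Fintype.card t) → 𝕜) →ₗ[𝕜] EllInfty 𝕜 :=
    { toFun := fun c => ⟨fun s => c (e (p s)), memℓp_infty ⟨‖c‖, by
        rintro _ ⟨s, rfl⟩
        exact norm_le_pi_norm c _⟩⟩
      map_add' := fun _ _ => rfl
      map_smul' := fun _ _ => rfl }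
  have hψ : ∀ c, ‖ψ c‖ ≤ 1 * ‖c‖ := by
    intro c
    rw [one_mul]
    exact lp.norm_le_of_forall_le (norm_nonneg _) fun s => norm_le_pi_norm c _
  refine ⟨Fintype.card t, Fintype.card_pos_iff.2 ⟨p 0⟩, (φ.mkContinuous 1 hφ, ψ.mkContinuous 1 hψ),
    φ.mkContinuous_norm_le zero_le_one hφ, ψ.mkContinuous_norm_le zero_le_one hψ, ?_⟩
  intro x hx
  refine lt_of_le_of_lt (lp.norm_le_of_forall_le (half_pos hδ).le fun s => ?_) (half_lt_self hδ)
  change ‖x (r (e.symm (e (p s)))) - x s‖ ≤ δ / 2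
  rw [Equiv.symm_apply_apply]
  have h1 := dist_le_pi_dist (v (r (p s))) (v s) ⟨x, hx⟩
  rw [hr, dist_comm (p s).1, dist_eq_norm] at h1
  have h2 : v (r (p s)) ⟨x, hx⟩ = (p s).1 ⟨x, hx⟩ := by rw [hr]
  rw [← h2] at h1
  exact h1.trans (hp s).le

/-! The first claim is of Banach–Stone type. The pointwise condition `|u| + |x| ≤ 1` says that `u +
c • x` stays in the unit ball for all unimodular `c`, so isometries preserve it. It encodes
domination and vanishing at a coordinate, so unit vectors go to unimodular multiples of unit vectors
and coordinates are carried along (`exists_isAssociatedPerm`).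

If orbits are bounded, some `α ^ M` is multiplication by a unimodular `θ`. The value of `α ^ k x` at
`s` then depends only on `θ s` and finitely many bounded scalars. Rounding these, with precision of
order `1 / n` for `θ s`, partitions `ℤ` into `O(n ^ 2)` cells. Sampling one point per cell bounds
the rank polynomially (`exists_rc_iterUnion_le`).

If orbits are unbounded, disjoint long orbit segments leave room to prescribe every finite sign
pattern. For each `m` this gives `m` vectors whose first `n` iterates behave on signs like an `ℓ_1`
basis of size `n * m` (`exists_iterates_norm_sum_sign_ge`). The `d` coordinates of a factorization
must detect all `2 ^ (n * m)` sign sums, while by exponential moments each detects only an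
exponentially small proportion. Hence `d ≥ exp (n * m / 32) / 4`, and the entropy is at least `m /
32` for every `m`. -/

/-! ### Isometries of `ℓ_∞` as weighted permutations. -/

section WeightedPermutation

variable {𝕜 : Type*} [RCLike 𝕜]

theorem exists_norm_one_norm_add_mul (a b : 𝕜) :
    ∃ c : 𝕜, ‖c‖ = 1 ∧ ‖a + c * b‖ = ‖a‖ + ‖b‖ := by
  obtain ⟨p, hp, hpa⟩ : ∃ p : 𝕜, ‖p‖ = 1 ∧ a = p * (‖a‖ : 𝕜) := by
    by_cases ha : a = 0
    · exact ⟨1, by simp, by simp [ha]⟩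
    · have : (‖a‖ : 𝕜) ≠ 0 := by simpa using ha
      exact ⟨a / ‖a‖, by simp [ha], by field_simp⟩
  obtain ⟨q, hq, hqb⟩ : ∃ q : 𝕜, ‖q‖ = 1 ∧ q * b = (‖b‖ : 𝕜) := by
    by_cases hb : b = 0
    · exact ⟨1, by simp, by simp [hb]⟩
    · exact ⟨‖b‖ / b, by simp [hb], by field_simp⟩
  refine ⟨p * q, by simp [hp, hq], ?_⟩
  calc ‖a + p * q * b‖ = ‖p * ((‖a‖ : 𝕜) + q * b)‖ := by
        rw [mul_add, ← hpa, mul_assoc]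
    _ = ‖((‖a‖ + ‖b‖ : ℝ) : 𝕜)‖ := by rw [norm_mul, hp, one_mul, hqb]; push_cast; rfl
    _ = ‖a‖ + ‖b‖ := by
        rw [RCLike.norm_ofReal, abs_of_nonneg (by positivity)]

theorem EllInfty.norm_apply_le (x : EllInfty 𝕜) (s : ℤ) : ‖x s‖ ≤ ‖x‖ :=
  lp.norm_apply_le_norm (by simp) x s

/-- `x` lies in the unit ball after adding any unimodular multiple of `u` exactly if
`|u| + |x| ≤ 1` pointwise. -/
theorem EllInfty.forall_norm_add_smul_le_iff (u x : EllInfty 𝕜) :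
    (∀ c : 𝕜, ‖c‖ = 1 → ‖u + c • x‖ ≤ 1) ↔ ∀ s, ‖u s‖ + ‖x s‖ ≤ 1 := by
  constructor
  · intro h s
    obtain ⟨c, hc, he⟩ := exists_norm_one_norm_add_mul (u s) (x s)
    rw [← he]
    exact (EllInfty.norm_apply_le (u + c • x) s).trans (h c hc)
  · intro h c hc
    refine lp.norm_le_of_forall_le zero_le_one fun s => ?_
    change ‖u s + c * x s‖ ≤ 1
    refine (norm_add_le _ _).trans ?_
    rw [norm_mul, hc, one_mul]
    exact h s

theorem LinearIsometryEquiv.norm_add_norm_le_one (α : EllInfty 𝕜 ≃ₗᵢ[𝕜] EllInfty 𝕜)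
    {u x : EllInfty 𝕜} (h : ∀ s, ‖u s‖ + ‖x s‖ ≤ 1) (s : ℤ) : ‖α u s‖ + ‖α x s‖ ≤ 1 := by
  revert s
  rw [← EllInfty.forall_norm_add_smul_le_iff] at h ⊢
  intro c hc
  rw [← map_smul, ← map_add, α.norm_map]
  exact h c hc

/-- The `s`-th unit vector of `ℓ_∞`. -/
noncomputable abbrev EllInfty.unit (𝕜 : Type*) [RCLike 𝕜] (s : ℤ) : EllInfty 𝕜 :=
  lp.single ∞ s (1 : 𝕜)

theorem EllInfty.unit_self (s : ℤ) : EllInfty.unit 𝕜 s s = 1 := by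
  simp [EllInfty.unit]

theorem EllInfty.unit_of_ne {s t : ℤ} (h : t ≠ s) : EllInfty.unit 𝕜 s t = 0 := by
  simp [EllInfty.unit, lp.single_apply, h]

theorem EllInfty.norm_unit (s : ℤ) : ‖EllInfty.unit 𝕜 s‖ = 1 := by
  refine le_antisymm (lp.norm_le_of_forall_le zero_le_one fun t => ?_) ?_
  · by_cases h : t = s
    · subst h; rw [EllInfty.unit_self]; simp
    · rw [EllInfty.unit_of_ne h]; simp
  · have h := EllInfty.norm_apply_le (EllInfty.unit 𝕜 s) s
    rwa [EllInfty.unit_self, norm_one] at h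

/-- A linear isometry of `ℓ_∞` preserves pointwise domination in the unit ball. -/
theorem LinearIsometryEquiv.norm_apply_le_of_le (α : EllInfty 𝕜 ≃ₗᵢ[𝕜] EllInfty 𝕜)
    {u y : EllInfty 𝕜} (hu : ‖u‖ ≤ 1) (h : ∀ s, ‖y s‖ ≤ ‖u s‖) (s : ℤ) :
    ‖α y s‖ ≤ ‖α u s‖ := by
  have hau : ‖α u s‖ ≤ 1 := (EllInfty.norm_apply_le _ s).trans ((α.norm_map u).le.trans hu)
  -- `x` uses up the slack of `α u` at `s`. Pulled back by `α.symm`, the condition survives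
  -- replacing `u` by the smaller `y`; pushed forward again, it bounds `α y` at `s`.
  set x : EllInfty 𝕜 := ((1 - ‖α u s‖ : ℝ) : 𝕜) • EllInfty.unit 𝕜 s
  have hxs : ‖x s‖ = 1 - ‖α u s‖ := by
    change ‖((1 - ‖α u s‖ : ℝ) : 𝕜) * EllInfty.unit 𝕜 s s‖ = _
    rw [EllInfty.unit_self, mul_one, RCLike.norm_ofReal, abs_of_nonneg (by linarith)]
  have h1 : ∀ t, ‖α u t‖ + ‖x t‖ ≤ 1 := by
    intro t
    by_cases ht : t = s
    · subst ht; rw [hxs]; linarith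
    · have : x t = 0 := by
        change ((1 - ‖α u s‖ : ℝ) : 𝕜) * EllInfty.unit 𝕜 s t = 0
        rw [EllInfty.unit_of_ne ht, mul_zero]
      rw [this, norm_zero, add_zero]
      exact (EllInfty.norm_apply_le _ t).trans ((α.norm_map u).le.trans hu)
  have h2 := α.symm.norm_add_norm_le_one h1
  simp only [LinearIsometryEquiv.symm_apply_apply] at h2
  have h3 := α.norm_add_norm_le_one (u := y) (x := α.symm x)
    (fun t => (add_le_add_left (h t) _).trans (h2 t)) s
  rw [LinearIsometryEquiv.apply_symm_apply, hxs] at h3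
  linarith

theorem EllInfty.eq_smul_unit {x : EllInfty 𝕜} {s : ℤ} (h : ∀ t, t ≠ s → x t = 0) :
    x = x s • EllInfty.unit 𝕜 s := by
  ext t
  change x t = x s * EllInfty.unit 𝕜 s t
  by_cases ht : t = s
  · subst ht; rw [EllInfty.unit_self, mul_one]
  · rw [h t ht, EllInfty.unit_of_ne ht, mul_zero]

/-- Truncating the image `v` to one coordinate `t` where it is nonzero gives a vector dominated by
`v`. Its preimage is dominated by the unit vector at `s`, hence is a multiple of it, so `v` is
itself supported at `t`. -/
theorem LinearIsometryEquiv.exists_map_unit (α : EllInfty 𝕜 ≃ₗᵢ[𝕜] EllInfty 𝕜) (s : ℤ) :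
    ∃ t, ∃ c : 𝕜, ‖c‖ = 1 ∧ α (EllInfty.unit 𝕜 s) = c • EllInfty.unit 𝕜 t := by
  set v := α (EllInfty.unit 𝕜 s) with hv
  have hv1 : ‖v‖ = 1 := by rw [hv, α.norm_map, EllInfty.norm_unit]
  obtain ⟨t, ht⟩ : ∃ t, v t ≠ 0 := by
    by_contra! h
    have : v = 0 := by ext t; exact h t
    rw [this, norm_zero] at hv1
    exact zero_ne_one hv1
  set y : EllInfty 𝕜 := v t • EllInfty.unit 𝕜 t with hy
  have hyt : y t = v t := by
    change v t * EllInfty.unit 𝕜 t t = v t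
    rw [EllInfty.unit_self, mul_one]
  have hyr : ∀ r, r ≠ t → y r = 0 := fun r hr => by
    change v t * EllInfty.unit 𝕜 t r = 0
    rw [EllInfty.unit_of_ne hr, mul_zero]
  have hyv : ∀ r, ‖y r‖ ≤ ‖v r‖ := by
    intro r
    by_cases hr : r = t
    · rw [hr, hyt]
    · rw [hyr r hr, norm_zero]; exact norm_nonneg _
  have hd := α.symm.norm_apply_le_of_le hv1.le hyv
  rw [hv, α.symm_apply_apply] at hd
  have hs := EllInfty.eq_smul_unit (x := α.symm y) (s := s) fun r hr => by
    have hdr := hd r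
    rwa [EllInfty.unit_of_ne hr, norm_zero, norm_le_zero_iff] at hdr
  set c := α.symm y s
  have hyc : y = c • v := by rw [hv, ← map_smul, ← hs, α.apply_symm_apply]
  have hc : c ≠ 0 := by
    rintro h
    rw [h, zero_smul] at hyc
    rw [hyc] at hyt
    exact ht hyt.symm
  have hvt := EllInfty.eq_smul_unit (x := v) (s := t) fun r hr => by
    have h0 : c * v r = 0 := by
      rw [← hyr r hr, hyc]; rfl
    exact (mul_eq_zero.1 h0).resolve_left hc
  refine ⟨t, v t, ?_, hvt⟩
  rw [hvt, norm_smul, EllInfty.norm_unit, mul_one] at hv1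
  exact hv1

theorem smul_unit_index_eq {s t : ℤ} {c : 𝕜}
    (h : EllInfty.unit 𝕜 s = c • EllInfty.unit 𝕜 t) : s = t := by
  by_contra hne
  have h1 : EllInfty.unit 𝕜 s s = c * EllInfty.unit 𝕜 t s :=
    congrArg (fun x : EllInfty 𝕜 => x s) h
  rw [EllInfty.unit_self, EllInfty.unit_of_ne hne, mul_zero] at h1
  exact one_ne_zero h1

theorem exists_isAssociatedPerm (α : EllInfty 𝕜 ≃ₗᵢ[𝕜] EllInfty 𝕜) :
    ∃ σ, IsAssociatedPerm α σ := by
  choose τ c hc hτ using α.exists_map_unit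
  choose ρ d _ hρ using α.symm.exists_map_unit
  have hl : ∀ s, τ (ρ s) = s := by
    intro s
    have h := congrArg α (hρ s)
    rw [α.apply_symm_apply, map_smul, hτ, smul_smul] at h
    exact (smul_unit_index_eq h).symm
  have hr : ∀ s, ρ (τ s) = s := by
    intro s
    have h := congrArg α.symm (hτ s)
    rw [α.symm_apply_apply, map_smul, hρ, smul_smul] at h
    exact (smul_unit_index_eq h).symm
  -- The unit vectors do not span a dense subspace, so `α` is not determined by them through
  -- continuity. Instead, `y s = 0` makes `y` compatible with the unit vector at `s`, whose image
  -- already has modulus `1` at `τ s`.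
  have key : ∀ (y : EllInfty 𝕜) s, ‖y‖ ≤ 1 → y s = 0 → α y (τ s) = 0 := by
    intro y s hy hys
    have h := α.norm_add_norm_le_one (u := EllInfty.unit 𝕜 s) (x := y) (fun t => by
      by_cases ht : t = s
      · subst ht; rw [EllInfty.unit_self, hys]; simp
      · rw [EllInfty.unit_of_ne ht, norm_zero, zero_add]
        exact (EllInfty.norm_apply_le y t).trans hy) (τ s)
    have h1 : α (EllInfty.unit 𝕜 s) (τ s) = c s := by
      rw [hτ]
      change c s * EllInfty.unit 𝕜 (τ s) (τ s) = c s
      rw [EllInfty.unit_self, mul_one]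
    rw [h1, hc] at h
    exact norm_le_zero_iff.1 (by linarith)
  have key' : ∀ (y : EllInfty 𝕜) s, y s = 0 → α y (τ s) = 0 := by
    intro y s hys
    by_cases h0 : y = 0
    · rw [h0, map_zero]; rfl
    have hn : (‖y‖ : 𝕜) ≠ 0 := by simpa using h0
    have h := key ((‖y‖ : 𝕜)⁻¹ • y) s (by rw [norm_smul]; simp [h0]) (by
      change (‖y‖ : 𝕜)⁻¹ * y s = 0
      rw [hys, mul_zero])
    rw [map_smul] at h
    exact (mul_eq_zero.1 h).resolve_left (inv_ne_zero hn)
  -- The permutation acts on arguments, so it is the inverse `ρ` of the map `τ` on unit vectors.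
  refine ⟨⟨ρ, τ, hl, hr⟩, fun s => c (ρ s), fun s => hc _, fun x s => ?_⟩
  change α x s = c (ρ s) * x (ρ s)
  have h := key' (x - x (ρ s) • EllInfty.unit 𝕜 (ρ s)) (ρ s) (by
    change x (ρ s) - x (ρ s) * EllInfty.unit 𝕜 (ρ s) (ρ s) = 0
    rw [EllInfty.unit_self, mul_one, sub_self])
  rw [hl, map_sub, map_smul, hτ, hl] at h
  have h' : α x s - x (ρ s) * (c (ρ s) * EllInfty.unit 𝕜 s s) = 0 := h
  rw [EllInfty.unit_self, mul_one] at h'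
  rw [sub_eq_zero.1 h', mul_comm]

theorem IsAssociatedPerm.unique {α : EllInfty 𝕜 ≃ₗᵢ[𝕜] EllInfty 𝕜} {σ τ : Equiv.Perm ℤ}
    (hσ : IsAssociatedPerm α σ) (hτ : IsAssociatedPerm α τ) : σ = τ := by
  obtain ⟨l, hl, hσ⟩ := hσ
  obtain ⟨m, _, hτ⟩ := hτ
  ext s
  by_contra hne
  have h := hσ (EllInfty.unit 𝕜 (σ s)) s
  rw [hτ, EllInfty.unit_self, EllInfty.unit_of_ne (Ne.symm hne), mul_zero, mul_one] at h
  have := hl s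
  rw [← h, norm_zero] at this
  exact zero_ne_one this

theorem IsAssociatedPerm.pow {α : EllInfty 𝕜 ≃ₗᵢ[𝕜] EllInfty 𝕜} {σ : Equiv.Perm ℤ}
    (h : IsAssociatedPerm α σ) (k : ℕ) : IsAssociatedPerm (α ^ k) (σ ^ k) := by
  induction k with
  | zero => exact ⟨1, by simp, by simp⟩
  | succ k ih =>
    obtain ⟨l, hl, h⟩ := h
    obtain ⟨m, hm, ih⟩ := ih
    refine ⟨fun s => m s * l ((σ ^ k) s), fun s => by simp [hl, hm], fun x s => ?_⟩
    rw [pow_succ, pow_succ']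
    change (α ^ k) (α x) s = _
    rw [ih, h, mul_assoc]
    rfl

end WeightedPermutation

/-! ### Periods and disjoint orbit segments of permutations of `ℤ`. -/

section Orbits

theorem Equiv.Perm.encard_zpowers_orbit_le {σ : Equiv.Perm ℤ} {s : ℤ} {p : ℕ} (hp : 0 < p)
    (h : (σ ^ p) s = s) : (MulAction.orbit (Subgroup.zpowers σ) s).encard ≤ p := by
  have hsub : MulAction.orbit (Subgroup.zpowers σ) s ⊆
      ((Finset.range p).image fun k : ℕ => (σ ^ k) s : Finset ℤ) := by
    rintro _ ⟨⟨_, z, rfl⟩, rfl⟩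
    have hfix : ∀ q : ℤ, ((σ ^ p) ^ q) s = s := fun q =>
      Equiv.Perm.zpow_apply_eq_self_of_apply_eq_self h q
    have hz : (σ ^ z) s = (σ ^ (z % p).toNat) s := by
      have hnn : 0 ≤ z % p := Int.emod_nonneg _ (by omega)
      conv_lhs => rw [← Int.emod_add_mul_ediv z p, zpow_add, zpow_mul, zpow_natCast]
      rw [Equiv.Perm.mul_apply, hfix, ← zpow_natCast, Int.toNat_of_nonneg hnn]
    simp only [Finset.coe_image, Finset.coe_range, Set.mem_image, Set.mem_Iio]
    refine ⟨(z % p).toNat, ?_, hz.symm⟩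
    have := Int.emod_lt_of_pos z (b := p) (by omega)
    omega
  refine (Set.encard_le_encard hsub).trans ?_
  rw [Set.encard_coe_eq_coe_finsetCard]
  exact_mod_cast Finset.card_image_le.trans (Finset.card_range p).le

theorem Equiv.Perm.injOn_pow_apply_of_forall_ne {σ : Equiv.Perm ℤ} {s : ℤ} {n : ℕ}
    (h : ∀ p, 0 < p → p < n → (σ ^ p) s ≠ s) :
    Set.InjOn (fun k : ℕ => (σ ^ k) s) (Set.Iio n) := by
  have aux : ∀ a b : ℕ, a < b → b < n → (σ ^ a) s ≠ (σ ^ b) s := by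
    intro a b hab hb he
    refine h (b - a) (by omega) (by omega) ?_
    apply (σ ^ a).injective
    rw [← Equiv.Perm.mul_apply, ← pow_add, Nat.add_sub_cancel' hab.le, he]
  intro a ha b hb he
  rcases lt_trichotomy a b with hab | hab | hab
  · exact absurd he (aux a b hab hb)
  · exact hab
  · exact absurd he.symm (aux b a hab ha)

theorem Equiv.Perm.injOn_pow_apply {σ : Equiv.Perm ℤ} {s : ℤ} {n : ℕ}
    (h : (n : ℕ∞) ≤ (MulAction.orbit (Subgroup.zpowers σ) s).encard) :
    Set.InjOn (fun k : ℕ => (σ ^ k) s) (Set.Iio n) := by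
  refine Equiv.Perm.injOn_pow_apply_of_forall_ne fun p hp hpn hps => ?_
  have h2 := h.trans (Equiv.Perm.encard_zpowers_orbit_le hp hps)
  rw [Nat.cast_le] at h2
  omega

/-- By pigeonhole every point has a period at most `N`, so `N!` is a common period. -/
theorem HasBoundedOrbits.exists_pow_eq_one {σ : Equiv.Perm ℤ} (h : HasBoundedOrbits σ) :
    ∃ M, 0 < M ∧ σ ^ M = 1 := by
  obtain ⟨N, hN⟩ := h
  refine ⟨N.factorial, N.factorial_pos, ?_⟩
  ext s
  obtain ⟨p, hp, hpN, hps⟩ : ∃ p, 0 < p ∧ p ≤ N ∧ (σ ^ p) s = s := by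
    by_contra! hne
    have hinj : Set.InjOn (fun k : ℕ => (σ ^ k) s) (Set.Iio (N + 1)) :=
      Equiv.Perm.injOn_pow_apply_of_forall_ne fun p hp hpN => hne p hp (by omega)
    have h1 := hinj.encard_image
    have h2 : (fun k : ℕ => (σ ^ k) s) '' Set.Iio (N + 1) ⊆
        MulAction.orbit (Subgroup.zpowers σ) s := by
      rintro _ ⟨k, _, rfl⟩
      exact ⟨⟨σ ^ k, k, by simp⟩, rfl⟩
    have h3 := (Set.encard_le_encard h2).trans (hN s)
    rw [h1, ← Finset.coe_range, Set.encard_coe_eq_coe_finsetCard, Finset.card_range] at h3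
    have : N + 1 ≤ N := by exact_mod_cast h3
    omega
  obtain ⟨q, hq⟩ := Nat.dvd_factorial hp hpN
  rw [hq, pow_mul]
  exact Equiv.Perm.pow_apply_eq_self_of_apply_eq_self hps q

/-- Without a bound on the orbits there are arbitrarily long injective orbit segments that avoid a
given finite set. -/
theorem exists_orbit_segment {σ : Equiv.Perm ℤ} (h : ¬ HasBoundedOrbits σ) (n : ℕ)
    (E : Finset ℤ) : ∃ s, Set.InjOn (fun k : ℕ => (σ ^ k) s) (Set.Iio n) ∧
      ∀ k < n, (σ ^ k) s ∉ E := by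
  simp only [HasBoundedOrbits, not_exists, not_forall, not_le] at h
  -- At most `n * E.card` points of an orbit meet `E` within `n` steps, so a good starting point
  -- remains; the extra `n` ensures injectivity even when `E` is empty.
  obtain ⟨s₀, hs₀⟩ := h (n * E.card + n)
  obtain ⟨s, hs, hsE⟩ : ∃ s ∈ MulAction.orbit (Subgroup.zpowers σ) s₀,
      ∀ k < n, (σ ^ k) s ∉ E := by
    by_contra! hcon
    have hsub : MulAction.orbit (Subgroup.zpowers σ) s₀ ⊆
        ((Finset.range n ×ˢ E).image fun q : ℕ × ℤ => (σ ^ q.1).symm q.2 : Finset ℤ) := by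
      intro s hs
      obtain ⟨k, hk, hkE⟩ := hcon s hs
      simp only [Finset.coe_image, Set.mem_image, Finset.mem_coe, Finset.mem_product,
        Finset.mem_range]
      exact ⟨(k, (σ ^ k) s), ⟨hk, hkE⟩, by simp⟩
    have h1 := Set.encard_le_encard hsub
    rw [Set.encard_coe_eq_coe_finsetCard] at h1
    have h2 := hs₀.trans_le h1
    rw [Nat.cast_lt] at h2
    have h4 := Finset.card_image_le (s := Finset.range n ×ˢ E)
      (f := fun q : ℕ × ℤ => (σ ^ q.1).symm q.2)
    rw [Finset.card_product, Finset.card_range] at h4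
    omega
  refine ⟨s, Equiv.Perm.injOn_pow_apply ?_, hsE⟩
  rw [MulAction.orbit_eq_iff.2 hs]
  refine le_trans ?_ hs₀.le
  exact_mod_cast Nat.le_add_left _ _

/-- Greedy choice along an enumeration of `T`: `E i` collects the points used before stage `i`, and
the next segment avoids them. Codes of no element of `T` get length `0`. -/
theorem exists_disjoint_orbit_segments {σ : Equiv.Perm ℤ} (h : ¬ HasBoundedOrbits σ) {T : Type*}
    [Countable T] (len : T → ℕ) :
    ∃ s : T → ℤ, Function.Injective fun q : Σ t, Fin (len t) => (σ ^ (q.2 : ℕ)) (s q.1) := by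
  choose g hinj havoid using exists_orbit_segment h
  have := Encodable.ofCountable T
  let l : ℕ → ℕ := fun i => ((Encodable.decode i : Option T).map len).getD 0
  let seg : ℕ → ℤ → Finset ℤ := fun n s => (Finset.range n).image fun k : ℕ => (σ ^ k) s
  let E : ℕ → Finset ℤ := fun i => Nat.rec ∅ (fun i E => E ∪ seg (l i) (g (l i) E)) i
  have hE : ∀ i, E (i + 1) = E i ∪ seg (l i) (g (l i) (E i)) := fun _ => rfl
  have hmono : Monotone E := monotone_nat_of_le_succ fun i => by
    rw [hE]; exact Finset.subset_union_left
  have hl : ∀ t, l (Encodable.encode t) = len t := fun t => by simp [l]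
  have hne : ∀ i j a b, i < j → a < l i → b < l j →
      (σ ^ a) (g (l i) (E i)) ≠ (σ ^ b) (g (l j) (E j)) := by
    intro i j a b hij ha hb he
    refine havoid (l j) (E j) b hb (hmono (Nat.succ_le_of_lt hij) ?_)
    rw [Nat.succ_eq_add_one, hE, ← he]
    exact Finset.mem_union_right _ (Finset.mem_image.2 ⟨a, Finset.mem_range.2 ha, rfl⟩)
  refine ⟨fun t => g (l (Encodable.encode t)) (E (Encodable.encode t)), ?_⟩
  rintro ⟨t, a⟩ ⟨t', b⟩ he
  have ha : (a : ℕ) < l (Encodable.encode t) := by rw [hl]; exact a.2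
  have hb : (b : ℕ) < l (Encodable.encode t') := by rw [hl]; exact b.2
  rcases lt_trichotomy (Encodable.encode t) (Encodable.encode t') with hlt | heq | hlt
  · exact absurd he (hne _ _ _ _ hlt ha hb)
  · obtain rfl := Encodable.encode_injective heq
    have hab : (a : ℕ) = b := hinj _ _ ha hb he
    rw [Fin.ext hab]
  · exact absurd he.symm (hne _ _ _ _ hlt hb ha)

end Orbits

/-! ### Upper bounds for the contractive rank, and zero entropy. -/

section ContractiveRank

variable {𝕜 : Type*} [RCLike 𝕜]

theorem iterUnion_finite {X : Type*} [NormedAddCommGroup X] [NormedSpace 𝕜 X] (α : X ≃ₗᵢ[𝕜] X)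
    {Ω : Set X} (hΩ : Ω.Finite) (n : ℕ) : (iterUnion α Ω n).Finite :=
  (Finset.range n).finite_toSet.biUnion fun _ _ => hΩ.image _

theorem pow_apply_mem_iterUnion {X : Type*} [NormedAddCommGroup X] [NormedSpace 𝕜 X]
    (α : X ≃ₗᵢ[𝕜] X) {Ω : Set X} {n k : ℕ} (hk : k < n) {x : X} (hx : x ∈ Ω) :
    (α ^ k) x ∈ iterUnion α Ω n :=
  Set.mem_biUnion (Finset.mem_coe.2 (Finset.mem_range.2 hk)) ⟨x, hx, rfl⟩

theorem hc_nonneg {X Y : Type*} [NormedAddCommGroup X] [NormedSpace 𝕜 X] [NormedAddCommGroup Y]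
    [NormedSpace 𝕜 Y] (ι : X →ₗᵢ[𝕜] Y) (α : X ≃ₗᵢ[𝕜] X) : 0 ≤ hc ι α := by
  have h : 0 ≤ hcAt ι α ∅ 1 := by
    refine Filter.le_limsup_of_frequently_le (Filter.Frequently.of_forall fun n => ?_)
    exact_mod_cast mul_nonneg (by positivity) (Real.log_natCast_nonneg _)
  exact h.trans ((le_iSup₂ (f := fun (δ : ℝ) (_ : 0 < δ) => hcAt ι α ∅ δ) 1 one_pos).trans
    (le_iSup₂ (f := fun (Ω : Set X) (_ : Ω.Finite) => hcOn ι α Ω) ∅ Set.finite_empty))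

/-- If the elements of `Ω` are almost constant on the cells of a finite partition of `ℤ`, then the
number of cells bounds the contractive rank. -/
theorem rc_le_card_of_cells {Y : Type*} [NormedAddCommGroup Y] [NormedSpace 𝕜 Y]
    (ι : EllInfty 𝕜 →ₗᵢ[𝕜] Y) {Ω : Set (EllInfty 𝕜)} {δ : ℝ} (hδ : 0 < δ) {F : Type*} [Fintype F]
    (κ : ℤ → F) (hκ : ∀ x ∈ Ω, ∀ s t, κ s = κ t → ‖x s - x t‖ ≤ δ / 2) :
    rc ι Ω δ ≤ Fintype.card F := by
  let e := Fintype.equivFin F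
  -- One representative per cell; its value on empty cells is arbitrary and harmless. `φ` samples at
  -- representatives and `ψ` extends constantly over cells.
  let r : F → ℤ := Function.invFun κ
  have hr : ∀ s, κ (r (κ s)) = κ s := fun s => Function.invFun_eq ⟨s, rfl⟩
  let φ : EllInfty 𝕜 →ₗ[𝕜] (Fin (Fintype.card F) → 𝕜) :=
    { toFun := fun x i => x (r (e.symm i))
      map_add' := fun _ _ => rfl
      map_smul' := fun _ _ => rfl }
  have hφ : ∀ x, ‖φ x‖ ≤ 1 * ‖x‖ := by
    intro x
    rw [one_mul, pi_norm_le_iff_of_nonneg (norm_nonneg _)]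
    exact fun i => EllInfty.norm_apply_le x _
  let ψ : (Fin (Fintype.card F) → 𝕜) →ₗ[𝕜] EllInfty 𝕜 :=
    { toFun := fun c => ⟨fun s => c (e (κ s)), memℓp_infty ⟨‖c‖, by
        rintro _ ⟨s, rfl⟩
        exact norm_le_pi_norm c _⟩⟩
      map_add' := fun _ _ => rfl
      map_smul' := fun _ _ => rfl }
  have hψ : ∀ c, ‖(ι.toLinearMap ∘ₗ ψ) c‖ ≤ 1 * ‖c‖ := by
    intro c
    rw [one_mul]
    change ‖ι (ψ c)‖ ≤ ‖c‖
    rw [ι.norm_map]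
    exact lp.norm_le_of_forall_le (norm_nonneg _) fun s => norm_le_pi_norm c _
  refine Nat.sInf_le ⟨Fintype.card_pos_iff.2 ⟨κ 0⟩,
    (φ.mkContinuous 1 hφ, (ι.toLinearMap ∘ₗ ψ).mkContinuous 1 hψ),
    φ.mkContinuous_norm_le zero_le_one hφ, LinearMap.mkContinuous_norm_le _ zero_le_one hψ, ?_⟩
  intro x hx
  change ‖ι (ψ (φ x)) - ι x‖ < δ
  rw [← map_sub, ι.norm_map]
  refine lt_of_le_of_lt (lp.norm_le_of_forall_le (half_pos hδ).le fun s => ?_) (half_lt_self hδ)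
  change ‖x (r (e.symm (e (κ s)))) - x s‖ ≤ δ / 2
  rw [Equiv.symm_apply_apply]
  exact hκ x hx _ _ (hr s)

theorem RCLike.norm_le_abs_re_add_abs_im (z : 𝕜) : ‖z‖ ≤ |RCLike.re z| + |RCLike.im z| := by
  refine abs_le_of_sq_le_sq' ?_ (by positivity) |>.2
  rw [RCLike.norm_sq_eq_def, add_sq, sq_abs, sq_abs]
  have := mul_nonneg (abs_nonneg (RCLike.re z)) (abs_nonneg (RCLike.im z))
  nlinarith

/-- The cell of `z` in the square grid of mesh `1 / m`. -/
noncomputable def gridCell (m : ℕ) (z : 𝕜) : ℤ × ℤ :=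
  (⌊(m : ℝ) * RCLike.re z⌋, ⌊(m : ℝ) * RCLike.im z⌋)

theorem norm_sub_le_of_gridCell_eq {m : ℕ} (hm : 0 < m) {z w : 𝕜}
    (h : gridCell m z = gridCell m w) : ‖z - w‖ ≤ 2 / m := by
  have hm' : (0 : ℝ) < m := by exact_mod_cast hm
  have aux : ∀ a b : ℝ, ⌊(m : ℝ) * a⌋ = ⌊(m : ℝ) * b⌋ → |a - b| ≤ 1 / m := by
    intro a b hab
    have h1 := Int.abs_sub_lt_one_of_floor_eq_floor hab
    rw [← mul_sub, abs_mul, abs_of_pos hm'] at h1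
    rw [le_div_iff₀ hm', mul_comm]
    exact h1.le
  have h1 := aux _ _ (congrArg Prod.fst h)
  have h2 := aux _ _ (congrArg Prod.snd h)
  refine (RCLike.norm_le_abs_re_add_abs_im (z - w)).trans ?_
  rw [map_sub, map_sub]
  calc _ ≤ 1 / (m : ℝ) + 1 / m := add_le_add h1 h2
    _ = 2 / m := by ring

theorem gridCell_mem {m B : ℕ} {z : 𝕜} (hz : ‖z‖ ≤ B) :
    gridCell m z ∈ Finset.Icc (-(m * B : ℕ) : ℤ) (m * B : ℕ) ×ˢ
      Finset.Icc (-(m * B : ℕ) : ℤ) (m * B : ℕ) := by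
  have aux : ∀ a : ℝ, |a| ≤ B →
      ⌊(m : ℝ) * a⌋ ∈ Finset.Icc (-(m * B : ℕ) : ℤ) (m * B : ℕ) := by
    intro a ha
    obtain ⟨h1, h2⟩ := abs_le.1 ha
    have hm : (0 : ℝ) ≤ m := by positivity
    rw [Finset.mem_Icc, Int.le_floor]
    constructor
    · push_cast
      nlinarith
    · refine Int.floor_le_iff.2 ?_
      push_cast
      nlinarith
  exact Finset.mem_product.2 ⟨aux _ ((RCLike.abs_re_le_norm z).trans hz),
    aux _ ((RCLike.abs_im_le_norm z).trans hz)⟩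

theorem norm_pow_sub_pow_le_of_norm_le_one {a b : 𝕜} (ha : ‖a‖ ≤ 1) (hb : ‖b‖ ≤ 1) (q : ℕ) :
    ‖a ^ q - b ^ q‖ ≤ q * ‖a - b‖ := by
  induction q with
  | zero => simp
  | succ q ih =>
    have h : a ^ (q + 1) - b ^ (q + 1) = a * (a ^ q - b ^ q) + (a - b) * b ^ q := by ring
    rw [h]
    refine (norm_add_le _ _).trans ?_
    rw [norm_mul, norm_mul, norm_pow]
    have h1 : ‖a‖ * ‖a ^ q - b ^ q‖ ≤ q * ‖a - b‖ :=
      (mul_le_of_le_one_left (norm_nonneg _) ha).trans ih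
    have h2 : ‖a - b‖ * ‖b‖ ^ q ≤ ‖a - b‖ :=
      mul_le_of_le_one_right (norm_nonneg _) (pow_le_one₀ (norm_nonneg _) hb)
    push_cast
    linarith

/-- If `α ^ M` is a multiplication operator, the contractive ranks of the iterates of a finite set
grow at most quadratically. -/
theorem exists_rc_iterUnion_le {Y : Type*} [NormedAddCommGroup Y] [NormedSpace 𝕜 Y]
    (ι : EllInfty 𝕜 →ₗᵢ[𝕜] Y) (α : EllInfty 𝕜 ≃ₗᵢ[𝕜] EllInfty 𝕜) {M : ℕ} (hM : 0 < M)
    (h : IsAssociatedPerm (α ^ M) 1) {Ω : Set (EllInfty 𝕜)} (hΩ : Ω.Finite) {δ : ℝ}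
    (hδ : 0 < δ) : ∃ C : ℕ, ∀ n, 0 < n → rc ι (iterUnion α Ω n) δ ≤ C * n ^ 2 := by
  obtain ⟨θ, hθ, hα⟩ := h
  classical
  have := hΩ.fintype
  obtain ⟨B, hB⟩ : ∃ B : ℕ, ∀ x ∈ Ω, ‖x‖ ≤ B := by
    obtain ⟨b, hb⟩ := hΩ.isBounded.exists_norm_le
    exact ⟨⌈b⌉₊, fun x hx => (hb x hx).trans (Nat.le_ceil b)⟩
  -- The total error below is `2 * (B + 1) / m`, which has to be at most `δ / 2`; `4` in place of
  -- `8` would do.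
  obtain ⟨m, hm⟩ := exists_nat_gt (8 * (B + 1) / δ)
  have hm0 : (0 : ℝ) < m := lt_of_le_of_lt (by positivity) hm
  have hm1 : 0 < m := by exact_mod_cast hm0
  rw [div_lt_iff₀ hδ] at hm
  have hpow : ∀ (q : ℕ) (x : EllInfty 𝕜) s, ((α ^ M) ^ q) x s = θ s ^ q * x s := by
    intro q
    induction q with
    | zero => simp
    | succ q ih =>
      intro x s
      rw [pow_succ]
      change ((α ^ M) ^ q) ((α ^ M) x) s = _
      rw [ih, hα, pow_succ, mul_assoc]
      rfl
  let G : ℕ → Finset (ℤ × ℤ) := fun K =>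
    Finset.Icc (-(K : ℕ) : ℤ) K ×ˢ Finset.Icc (-(K : ℕ) : ℤ) K
  have hG : ∀ K, (G K).card = (2 * K + 1) ^ 2 := by
    intro K
    rw [Finset.card_product, Int.card_Icc]
    rw [show ((K : ℤ) + 1 - -K).toNat = 2 * K + 1 by omega, sq]
  refine ⟨Fintype.card (Fin M × Ω → G (m * B)) * (2 * m + 1) ^ 2, fun n hn => ?_⟩
  have hbd : ∀ (r : ℕ) (x : Ω) s, ‖(α ^ r) x.1 s‖ ≤ B := fun r x s =>
    (EllInfty.norm_apply_le _ s).trans (((α ^ r).norm_map x.1).le.trans (hB x.1 x.2))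
  -- Powers of `θ s` up to the `n`th occur and magnify errors by up to `n`, hence the mesh `1 / (m *
  -- n)` for `θ s`. Only this factor depends on `n`, and the grid is two-dimensional, whence `n ^
  -- 2`.
  let κ : ℤ → (Fin M × Ω → G (m * B)) × G (m * n * 1) := fun s =>
    (fun p => ⟨gridCell m ((α ^ (p.1 : ℕ)) p.2.1 s), gridCell_mem (hbd _ _ _)⟩,
      ⟨gridCell (m * n) (θ s), gridCell_mem (by rw [hθ]; simp)⟩)
  have hκ : ∀ x ∈ iterUnion α Ω n, ∀ s t, κ s = κ t → ‖x s - x t‖ ≤ δ / 2 := by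
    intro y hy s t hst
    simp only [iterUnion, Set.mem_iUnion, Finset.mem_range] at hy
    obtain ⟨k, hk, x, hx, rfl⟩ := hy
    have hsplit : ∀ u, (α ^ k) x u = θ u ^ (k / M) * (α ^ (k % M)) x u := by
      intro u
      rw [← hpow, ← pow_mul]
      conv_lhs => rw [← Nat.div_add_mod k M, pow_add]
      rfl
    have h1 : ‖(α ^ (k % M)) x s - (α ^ (k % M)) x t‖ ≤ 2 / m :=
      norm_sub_le_of_gridCell_eq hm1 (congrArg Subtype.val
        (congrFun (congrArg Prod.fst hst) (⟨k % M, Nat.mod_lt _ hM⟩, ⟨x, hx⟩)))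
    have h2 : ‖θ s - θ t‖ ≤ 2 / (m * n : ℕ) :=
      norm_sub_le_of_gridCell_eq (Nat.mul_pos hm1 hn)
        (congrArg Subtype.val (congrArg Prod.snd hst))
    have h3 : ‖θ s ^ (k / M) - θ t ^ (k / M)‖ ≤ 2 / m := by
      refine (norm_pow_sub_pow_le_of_norm_le_one (hθ s).le (hθ t).le _).trans ?_
      have hkn : ((k / M : ℕ) : ℝ) ≤ n := by
        exact_mod_cast (Nat.div_le_self k M).trans hk.le
      have hn0 : (0 : ℝ) < n := by exact_mod_cast hn
      calc _ ≤ (n : ℝ) * (2 / (m * n : ℕ)) :=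
            mul_le_mul hkn h2 (norm_nonneg _) hn0.le
        _ = 2 / m := by push_cast; field_simp
    rw [hsplit, hsplit]
    have h4 : ∀ a b c d : 𝕜, a * b - c * d = a * (b - d) + (a - c) * d := fun a b c d => by ring
    rw [h4]
    refine (norm_add_le _ _).trans ?_
    rw [norm_mul, norm_mul, norm_pow, hθ, one_pow, one_mul]
    have h5 := mul_le_mul h3 (hbd (k % M) ⟨x, hx⟩ t) (norm_nonneg _) (by positivity)
    refine (add_le_add h1 h5).trans ?_
    rw [← sub_nonneg]
    have : δ / 2 - (2 / m + 2 / m * B) = (δ * m - 4 * (B + 1)) / (2 * m) := by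
      field_simp; ring
    rw [this]
    have hB0 : (0 : ℝ) ≤ B := by positivity
    exact div_nonneg (by linarith) (by positivity)
  refine (rc_le_card_of_cells ι hδ κ hκ).trans ?_
  rw [Fintype.card_prod, Fintype.card_coe (G _), hG, mul_assoc _ (_ ^ 2), ← mul_pow]
  gcongr
  nlinarith

theorem tendsto_log_const_mul_sq_div (C : ℕ) :
    Filter.Tendsto (fun n : ℕ => (1 / n : ℝ) * Real.log (C * (n : ℝ) ^ 2)) Filter.atTop
      (nhds 0) := by
  have h1 : Filter.Tendsto (fun n : ℕ => Real.log C * (1 / n : ℝ)) Filter.atTop (nhds 0) := by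
    simpa using tendsto_one_div_atTop_nhds_zero_nat.const_mul (Real.log C)
  have h2 : Filter.Tendsto (fun n : ℕ => 2 * (Real.log n / n)) Filter.atTop (nhds 0) := by
    have h := Real.isLittleO_log_id_atTop.tendsto_div_nhds_zero.comp
      (tendsto_natCast_atTop_atTop (R := ℝ))
    simpa using h.const_mul 2
  by_cases hC : C = 0
  · simp [hC]
  have h3 := h1.add h2
  rw [add_zero] at h3
  refine h3.congr' ?_
  filter_upwards [Filter.eventually_gt_atTop 0] with n hn
  rw [Real.log_mul (by exact_mod_cast hC) (by positivity), Real.log_pow]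
  push_cast
  ring

theorem hc_eq_zero_of_hasBoundedOrbits {Y : Type*} [NormedAddCommGroup Y] [NormedSpace 𝕜 Y]
    (ι : EllInfty 𝕜 →ₗᵢ[𝕜] Y) {α : EllInfty 𝕜 ≃ₗᵢ[𝕜] EllInfty 𝕜} {σ : Equiv.Perm ℤ}
    (hα : IsAssociatedPerm α σ) (hσ : HasBoundedOrbits σ) : hc ι α = 0 := by
  refine le_antisymm (iSup₂_le fun Ω hΩ => iSup₂_le fun δ hδ => ?_) (hc_nonneg ι α)
  obtain ⟨M, hM, hσM⟩ := hσ.exists_pow_eq_one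
  obtain ⟨C, hC⟩ := exists_rc_iterUnion_le ι α hM (hσM ▸ hα.pow M) hΩ hδ
  have hlim : Filter.Tendsto
      (fun n : ℕ => (((1 / n : ℝ) * Real.log (C * (n : ℝ) ^ 2) : ℝ) : EReal)) Filter.atTop
      (nhds ((0 : ℝ) : EReal)) :=
    (continuous_coe_real_ereal.tendsto 0).comp (tendsto_log_const_mul_sq_div C)
  rw [← EReal.coe_zero, ← hlim.limsup_eq]
  refine Filter.limsup_le_limsup ?_
  filter_upwards [Filter.eventually_gt_atTop 0] with n hn
  refine EReal.coe_le_coe_iff.2 (mul_le_mul_of_nonneg_left ?_ (by positivity))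
  rcases Nat.eq_zero_or_pos (rc ι (iterUnion α Ω n) δ) with h0 | h0
  · rw [h0, Nat.cast_zero, Real.log_zero]
    exact_mod_cast Real.log_natCast_nonneg (C * n ^ 2)
  · exact Real.log_le_log (by exact_mod_cast h0) (by exact_mod_cast hC n hn)

end ContractiveRank

/-! ### Counting sign patterns, and infinite entropy. -/

section SignPatterns

/-- The sign `1` or `-1` encoded by a Boolean. -/
def boolSign (R : Type*) [Ring R] (b : Bool) : R := bif b then 1 else -1

theorem boolSign_mul_self {R : Type*} [Ring R] (b : Bool) : boolSign R b * boolSign R b = 1 := by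
  cases b <;> simp [boolSign]

theorem norm_boolSign {𝕜 : Type*} [RCLike 𝕜] (b : Bool) : ‖boolSign 𝕜 b‖ = 1 := by
  cases b <;> simp [boolSign]

theorem re_boolSign_mul {𝕜 : Type*} [RCLike 𝕜] (b : Bool) (z : 𝕜) :
    RCLike.re (boolSign 𝕜 b * z) = boolSign ℝ b * RCLike.re z := by
  cases b <;> simp [boolSign]

theorem im_boolSign_mul {𝕜 : Type*} [RCLike 𝕜] (b : Bool) (z : 𝕜) :
    RCLike.im (boolSign 𝕜 b * z) = boolSign ℝ b * RCLike.im z := by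
  cases b <;> simp [boolSign]

variable {J : Type*} [Fintype J] [DecidableEq J]

/-- The exponential moment bound for sums with random signs. -/
theorem sum_exp_mul_sum_boolSign_le {u : J → ℝ} (hu : ∀ j, |u j| ≤ 1) (t : ℝ) :
    ∑ ε : J → Bool, Real.exp (t * ∑ j, boolSign ℝ (ε j) * u j) ≤
      2 ^ Fintype.card J * Real.exp (Fintype.card J * (t ^ 2 / 2)) := by
  have h1 : ∀ ε : J → Bool, Real.exp (t * ∑ j, boolSign ℝ (ε j) * u j) =
      ∏ j, Real.exp (t * (boolSign ℝ (ε j) * u j)) := fun ε => by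
    rw [Finset.mul_sum, Real.exp_sum]
  simp_rw [h1]
  rw [← Fintype.prod_sum (fun j (b : Bool) => Real.exp (t * (boolSign ℝ b * u j)))]
  have h2 : ∀ j, ∑ b : Bool, Real.exp (t * (boolSign ℝ b * u j)) ≤
      2 * Real.exp (t ^ 2 / 2) := by
    intro j
    have h3 : ∑ b : Bool, Real.exp (t * (boolSign ℝ b * u j)) = 2 * Real.cosh (t * u j) := by
      rw [Fintype.sum_bool, Real.cosh_eq]
      simp only [boolSign, cond_true, cond_false, one_mul, neg_mul, mul_neg]
      ring
    rw [h3]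
    have h4 : (t * u j) ^ 2 ≤ t ^ 2 := by
      rw [mul_pow]
      exact mul_le_of_le_one_right (sq_nonneg t) ((sq_le_one_iff_abs_le_one _).2 (hu j))
    have h5 := (Real.cosh_le_exp_half_sq (t * u j)).trans
      (Real.exp_le_exp.2 (div_le_div_of_nonneg_right h4 zero_le_two))
    linarith
  refine (Finset.prod_le_prod (fun j _ => Finset.sum_nonneg fun _ _ => (Real.exp_pos _).le)
    fun j _ => h2 j).trans_eq ?_
  rw [Finset.prod_const, Finset.card_univ, mul_pow, ← Real.exp_nat_mul]

variable {𝕜 : Type*} [RCLike 𝕜]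

/-- If `d` vectors of scalars in the unit disc suffice to norm all sign patterns up to a factor
`1 / 2`, then `d` is exponentially large. -/
theorem exp_card_le_of_forall_sign {d : ℕ} {z : Fin d → J → 𝕜} (hz : ∀ i j, ‖z i j‖ ≤ 1)
    (h : ∀ ε : J → Bool, ∃ i,
      (Fintype.card J : ℝ) / 2 ≤ ‖∑ j, boolSign 𝕜 (ε j) * z i j‖) :
    Real.exp (Fintype.card J / 32) ≤ 4 * d := by
  set P : ℝ := (Fintype.card J : ℝ) with hP
  let A : Fin d → (J → Bool) → ℝ := fun i ε => ∑ j, boolSign ℝ (ε j) * RCLike.re (z i j)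
  let B : Fin d → (J → Bool) → ℝ := fun i ε => ∑ j, boolSign ℝ (ε j) * RCLike.im (z i j)
  -- A sum of modulus at least `P / 2` has real or imaginary part at least `P / 4` in absolute
  -- value, so one of the four exponentials reaches `exp (P / 16)`, while each averages at most `exp
  -- (P / 32)` over the signs. The parameter `t = 1 / 4` maximizes the gain `t / 4 - t ^ 2 / 2`.
  let f : Fin d → (J → Bool) → ℝ := fun i ε =>
    Real.exp (1 / 4 * A i ε) + Real.exp (-(1 / 4) * A i ε) +
      (Real.exp (1 / 4 * B i ε) + Real.exp (-(1 / 4) * B i ε))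
  have habs : ∀ a : ℝ, P / 4 ≤ |a| →
      Real.exp (P / 16) ≤ Real.exp (1 / 4 * a) + Real.exp (-(1 / 4) * a) := by
    intro a ha
    rcases le_abs.1 ha with ha | ha
    · exact (Real.exp_le_exp.2 (by linarith)).trans (le_add_of_nonneg_right (Real.exp_pos _).le)
    · exact (Real.exp_le_exp.2 (by linarith)).trans (le_add_of_nonneg_left (Real.exp_pos _).le)
  have hlow : ∀ ε, Real.exp (P / 16) ≤ ∑ i, f i ε := by
    intro ε
    obtain ⟨i, hi⟩ := h ε
    refine le_trans ?_ (Finset.single_le_sum (f := fun i => f i ε)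
      (fun i _ => by positivity) (Finset.mem_univ i))
    have hre : RCLike.re (∑ j, boolSign 𝕜 (ε j) * z i j) = A i ε := by
      simp only [map_sum, re_boolSign_mul, A]
    have him : RCLike.im (∑ j, boolSign 𝕜 (ε j) * z i j) = B i ε := by
      simp only [map_sum, im_boolSign_mul, B]
    have hsum := hi.trans (RCLike.norm_le_abs_re_add_abs_im _)
    rw [hre, him] at hsum
    rcases le_or_gt (P / 4) |A i ε| with hA | hA
    · exact (habs _ hA).trans (le_add_of_nonneg_right (by positivity))
    · exact (habs (B i ε) (by linarith)).trans (le_add_of_nonneg_left (by positivity))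
  have hup : ∀ i, ∑ ε, f i ε ≤ 4 * (2 ^ Fintype.card J * Real.exp (P / 32)) := by
    intro i
    have hr : ∀ j, |RCLike.re (z i j)| ≤ 1 := fun j => (RCLike.abs_re_le_norm _).trans (hz i j)
    have hm : ∀ j, |RCLike.im (z i j)| ≤ 1 := fun j => (RCLike.abs_im_le_norm _).trans (hz i j)
    have h1 := sum_exp_mul_sum_boolSign_le hr (1 / 4)
    have h2 := sum_exp_mul_sum_boolSign_le hr (-(1 / 4))
    have h3 := sum_exp_mul_sum_boolSign_le hm (1 / 4)
    have h4 := sum_exp_mul_sum_boolSign_le hm (-(1 / 4))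
    rw [← hP, show P * ((1 / 4) ^ 2 / 2) = P / 32 by ring] at h1 h3
    rw [← hP, show P * ((-(1 / 4)) ^ 2 / 2) = P / 32 by ring] at h2 h4
    simp only [f, Finset.sum_add_distrib]
    linarith
  have h1 : (2 : ℝ) ^ Fintype.card J * Real.exp (P / 16) ≤
      d * (4 * (2 ^ Fintype.card J * Real.exp (P / 32))) := by
    calc (2 : ℝ) ^ Fintype.card J * Real.exp (P / 16)
        = ∑ _ε : J → Bool, Real.exp (P / 16) := by simp
      _ ≤ ∑ ε, ∑ i, f i ε := Finset.sum_le_sum fun ε _ => hlow ε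
      _ = ∑ i, ∑ ε, f i ε := Finset.sum_comm
      _ ≤ ∑ _i : Fin d, 4 * (2 ^ Fintype.card J * Real.exp (P / 32)) :=
          Finset.sum_le_sum fun i _ => hup i
      _ = _ := by simp
  have h2 : Real.exp (P / 16) = Real.exp (P / 32) * Real.exp (P / 32) := by
    rw [← Real.exp_add]; congr 1; ring
  have h3 : (0 : ℝ) < 2 ^ Fintype.card J * Real.exp (P / 32) := by positivity
  refine le_of_mul_le_mul_left ?_ h3
  rw [h2] at h1
  linarith

/-- A factorization through `ℓ_∞^d` that is accurate up to `1 / 2` on vectors spanning `ℓ_1` (as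
tested on signs) needs exponentially many dimensions. -/
theorem exp_card_le_of_mem_CA [Nonempty J] {X Y : Type*} [NormedAddCommGroup X] [NormedSpace 𝕜 X]
    [NormedAddCommGroup Y] [NormedSpace 𝕜 Y] (ι : X →ₗᵢ[𝕜] Y) {Ω : Set X} {y : J → X}
    (hyΩ : ∀ j, y j ∈ Ω) (hy : ∀ j, ‖y j‖ ≤ 1)
    (hl : ∀ ε : J → Bool, (Fintype.card J : ℝ) ≤ ‖∑ j, boolSign 𝕜 (ε j) • y j‖) {d : ℕ}
    (h : (CA ι.toContinuousLinearMap Ω (1 / 2) d).Nonempty) :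
    Real.exp (Fintype.card J / 32) ≤ 4 * d := by
  obtain ⟨⟨φ, ψ⟩, hφ, hψ, hφψ⟩ := h
  simp only at hφ hψ hφψ
  have hP : (0 : ℝ) < Fintype.card J := by exact_mod_cast Fintype.card_pos
  refine exp_card_le_of_forall_sign (z := fun i j => φ (y j) i) (fun i j => ?_) fun ε => ?_
  · exact (norm_le_pi_norm _ i).trans ((φ.le_of_opNorm_le hφ _).trans (by rw [one_mul]; exact hy j))
  · set v := ∑ j, boolSign 𝕜 (ε j) • y j with hv
    -- The errors of `1 / 2` add up to at most half the norm of `v`; as `ψ` is contractive, `φ v`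
    -- retains the other half.
    have h1 : ‖ψ (φ v) - ι v‖ ≤ Fintype.card J / 2 := by
      have : ψ (φ v) - ι v = ∑ j, boolSign 𝕜 (ε j) • (ψ (φ (y j)) - ι (y j)) := by
        simp only [hv, map_sum, map_smul, smul_sub, Finset.sum_sub_distrib]
      rw [this]
      refine (norm_sum_le _ _).trans ?_
      calc _ ≤ ∑ _j : J, (1 / 2 : ℝ) := Finset.sum_le_sum fun j _ => by
            rw [norm_smul, norm_boolSign, one_mul]; exact (hφψ _ (hyΩ j)).le
        _ = _ := by simp; ring
    have h2 : ‖ψ (φ v)‖ ≤ ‖φ v‖ := by simpa using ψ.le_of_opNorm_le hψ (φ v)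
    have h3 : ‖ι v‖ ≤ ‖ψ (φ v)‖ + ‖ψ (φ v) - ι v‖ := by
      have := norm_sub_le (ψ (φ v)) (ψ (φ v) - ι v)
      rwa [sub_sub_cancel] at this
    rw [ι.norm_map] at h3
    have h4 : (Fintype.card J : ℝ) / 2 ≤ ‖φ v‖ := by linarith [hl ε]
    by_contra! hcon
    refine absurd h4 (not_le.2 ((pi_norm_lt_iff (by positivity)).2 fun i => ?_))
    have : φ v i = ∑ j, boolSign 𝕜 (ε j) * φ (y j) i := by
      simp only [hv, map_sum, map_smul, Finset.sum_apply, Pi.smul_apply, smul_eq_mul]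
    rw [this]
    exact hcon i

/-- If `σ` has unbounded orbits, there are finitely many vectors all of whose iterates under `α`
span `ℓ_1` (as tested on signs). -/
theorem exists_iterates_norm_sum_sign_ge {α : EllInfty 𝕜 ≃ₗᵢ[𝕜] EllInfty 𝕜} {σ : Equiv.Perm ℤ}
    (hα : IsAssociatedPerm α σ) (hσ : ¬ HasBoundedOrbits σ) (m : ℕ) :
    ∃ x : Fin m → EllInfty 𝕜, (∀ j, ‖x j‖ ≤ 1) ∧ ∀ (n : ℕ) (ε : Fin n × Fin m → Bool),
      (Fintype.card (Fin n × Fin m) : ℝ) ≤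
        ‖∑ p, boolSign 𝕜 (ε p) • (α ^ (p.1 : ℕ)) (x p.2)‖ := by
  choose Λ hΛ hΛα using fun k => hα.pow k
  -- One segment for each length `n` and each sign pattern, so that the same `m` vectors serve all
  -- `n` at once.
  obtain ⟨s, hs⟩ := exists_disjoint_orbit_segments hσ
    (T := Σ n : ℕ, (Fin n × Fin m → Bool)) fun t => t.1
  -- The inverse cancels the weight of `α ^ k`, so at the start of the segment for `ε` the iterates
  -- take exactly the values `ε` and every term of the signed sum is `1`.
  let val : Fin m → (Σ t : (Σ n : ℕ, (Fin n × Fin m → Bool)), Fin t.1) → 𝕜 := fun j q =>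
    (Λ q.2 (s q.1))⁻¹ * boolSign 𝕜 (q.1.2 (q.2, j))
  have hval : ∀ j q, ‖val j q‖ ≤ 1 := fun j q => by
    simp only [val, norm_mul, norm_inv, hΛ, norm_boolSign]; norm_num
  let w : Fin m → ℤ → 𝕜 := fun j =>
    Function.extend (fun q : (Σ t : (Σ n : ℕ, (Fin n × Fin m → Bool)), Fin t.1) =>
      (σ ^ (q.2 : ℕ)) (s q.1)) (val j) 0
  have hw : ∀ j u, ‖w j u‖ ≤ 1 := by
    intro j u
    by_cases hu : ∃ q : (Σ t : (Σ n : ℕ, (Fin n × Fin m → Bool)), Fin t.1),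
      (σ ^ (q.2 : ℕ)) (s q.1) = u
    · obtain ⟨q, rfl⟩ := hu
      simp only [w, hs.extend_apply]
      exact hval j q
    · simp only [w, Function.extend_apply' _ _ _ hu]
      simp
  let x : Fin m → EllInfty 𝕜 := fun j => ⟨w j, memℓp_infty ⟨1, by
    rintro _ ⟨u, rfl⟩
    exact hw j u⟩⟩
  refine ⟨x, fun j => lp.norm_le_of_forall_le zero_le_one (hw j), fun n ε => ?_⟩
  refine le_trans ?_ (EllInfty.norm_apply_le _ (s ⟨n, ε⟩))
  have hone : ∀ p : Fin n × Fin m,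
      (boolSign 𝕜 (ε p) • (α ^ (p.1 : ℕ)) (x p.2)) (s ⟨n, ε⟩) = 1 := by
    intro p
    change boolSign 𝕜 (ε p) * (α ^ (p.1 : ℕ)) (x p.2) (s ⟨n, ε⟩) = 1
    rw [hΛα]
    have hx : x p.2 ((σ ^ (p.1 : ℕ)) (s ⟨n, ε⟩)) = val p.2 ⟨⟨n, ε⟩, p.1⟩ :=
      hs.extend_apply (val p.2) 0 ⟨⟨n, ε⟩, p.1⟩
    have hne : Λ (p.1 : ℕ) (s ⟨n, ε⟩) ≠ 0 := by
      rw [← norm_ne_zero_iff, hΛ]; exact one_ne_zero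
    rw [hx]
    change boolSign 𝕜 (ε p) * (Λ p.1 (s ⟨n, ε⟩) *
      ((Λ p.1 (s ⟨n, ε⟩))⁻¹ * boolSign 𝕜 (ε p))) = 1
    rw [mul_inv_cancel_left₀ hne, boolSign_mul_self]
  have hsum : (∑ p, boolSign 𝕜 (ε p) • (α ^ (p.1 : ℕ)) (x p.2) : EllInfty 𝕜) (s ⟨n, ε⟩) =
      (Fintype.card (Fin n × Fin m) : 𝕜) := by
    rw [lp.coeFn_sum, Finset.sum_apply, Finset.sum_congr rfl fun p _ => hone p]
    simp
  rw [hsum, RCLike.norm_natCast]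

theorem hc_eq_top_of_not_hasBoundedOrbits {Y : Type*} [NormedAddCommGroup Y] [NormedSpace 𝕜 Y]
    {ι : EllInfty 𝕜 →ₗᵢ[𝕜] Y} (hι : IsCAEmbedding ι) {α : EllInfty 𝕜 ≃ₗᵢ[𝕜] EllInfty 𝕜}
    {σ : Equiv.Perm ℤ} (hα : IsAssociatedPerm α σ) (hσ : ¬ HasBoundedOrbits σ) :
    hc ι α = ⊤ := by
  have key : ∀ m : ℕ, 0 < m → (((m : ℝ) / 32 : ℝ) : EReal) ≤ hc ι α := by
    intro m hm
    obtain ⟨x, hx, hl⟩ := exists_iterates_norm_sum_sign_ge hα hσ m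
    refine le_trans ?_ (le_iSup₂ (f := fun (Ω : Set (EllInfty 𝕜)) (_ : Ω.Finite) => hcOn ι α Ω)
      (Set.range x) (Set.finite_range x))
    refine le_trans ?_ (le_iSup₂ (f := fun (δ : ℝ) (_ : 0 < δ) => hcAt ι α (Set.range x) δ)
      (1 / 2) one_half_pos)
    have hlim : Filter.Tendsto (fun n : ℕ => (((m : ℝ) / 32 - Real.log 4 * (1 / n) : ℝ) : EReal))
        Filter.atTop (nhds (((m : ℝ) / 32 : ℝ) : EReal)) := by
      refine (continuous_coe_real_ereal.tendsto _).comp ?_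
      simpa using (tendsto_one_div_atTop_nhds_zero_nat.const_mul (Real.log 4)).const_sub
        ((m : ℝ) / 32)
    rw [← hlim.limsup_eq]
    refine Filter.limsup_le_limsup ?_
    filter_upwards [Filter.eventually_gt_atTop 0] with n hn
    refine EReal.coe_le_coe_iff.2 ?_
    -- The CA embedding property is what makes the infimum attained, rather than the default `0` of
    -- an empty set.
    have hmem : rc ι (iterUnion α (Set.range x) n) (1 / 2) ∈ {d : ℕ | 0 < d ∧
        (CA ι.toContinuousLinearMap (iterUnion α (Set.range x) n) (1 / 2) d).Nonempty} :=
      Nat.sInf_mem (hι _ (iterUnion_finite α (Set.finite_range x) n) (1 / 2) one_half_pos)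
    have : Nonempty (Fin n × Fin m) := ⟨(⟨0, hn⟩, ⟨0, hm⟩)⟩
    have h1 := exp_card_le_of_mem_CA ι
      (y := fun p : Fin n × Fin m => (α ^ (p.1 : ℕ)) (x p.2))
      (fun p => pow_apply_mem_iterUnion α p.1.2 (Set.mem_range_self p.2))
      (fun p => ((α ^ (p.1 : ℕ)).norm_map _).le.trans (hx p.2)) (hl n) hmem.2
    have hr : (0 : ℝ) < rc ι (iterUnion α (Set.range x) n) (1 / 2) := by exact_mod_cast hmem.1
    have h2 := (Real.le_log_iff_exp_le (by positivity)).2 h1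
    rw [Real.log_mul (by norm_num) hr.ne', Fintype.card_prod, Fintype.card_fin,
      Fintype.card_fin] at h2
    have hn0 : (0 : ℝ) < n := by exact_mod_cast hn
    calc (m : ℝ) / 32 - Real.log 4 * (1 / n) = 1 / n * ((n * m : ℕ) / 32 - Real.log 4) := by
          push_cast; field_simp
      _ ≤ _ := mul_le_mul_of_nonneg_left (by linarith) (by positivity)
  rw [EReal.eq_top_iff_forall_lt]
  intro y
  obtain ⟨m, hm⟩ := exists_nat_gt (32 * |y|)
  have hm0 : 0 < m := by
    have h0 : (0 : ℝ) < m := lt_of_le_of_lt (by positivity) hm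
    exact_mod_cast h0
  refine lt_of_lt_of_le (EReal.coe_lt_coe_iff.2 ?_) (key m hm0)
  linarith [le_abs_self y]

end SignPatterns

theorem proposition10 {𝕜 : Type*} [RCLike 𝕜] (α : EllInfty 𝕜 ≃ₗᵢ[𝕜] EllInfty 𝕜) :
    (∃! σ : Equiv.Perm ℤ, IsAssociatedPerm α σ) ∧
    ∀ σ : Equiv.Perm ℤ, IsAssociatedPerm α σ →
      ∀ (Y : Type*) [NormedAddCommGroup Y] [NormedSpace 𝕜 Y] [CompleteSpace Y]
        (ι : EllInfty 𝕜 →ₗᵢ[𝕜] Y), IsCAEmbedding ι →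
        (HasBoundedOrbits σ → hc ι α = 0) ∧ (¬ HasBoundedOrbits σ → hc ι α = ⊤) := by
  refine ⟨?_, fun σ hσ Y _ _ _ ι hι => ⟨hc_eq_zero_of_hasBoundedOrbits ι hσ,
    hc_eq_top_of_not_hasBoundedOrbits hι hσ⟩⟩
  obtain ⟨σ, hσ⟩ := exists_isAssociatedPerm α
  exact ⟨σ, hσ, fun τ hτ => hτ.unique hσ⟩
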